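/- Let $k$ be a field, let $X$ be a finite set, and let $\mathrm{BC}(X)$ be the free bicommutative algebra over $k$ generated by $X$, i.e. the free nonassociative algebra on $X$ modulo the identities $x(yz)=y(xz)$ and $(xy)z=(xz)y$. For nonempty commutative words $u=z_1\cdots z_p$ and $v=y_1\cdots y_q$ over $X$ put $[u;v]=z_1(z_2(\cdots z_{p-1}((\cdots((z_py_1)y_2)\cdots)y_q)\cdots))\in\mathrm{BC}(X)$. This does not depend on the order of the letters in $u$ and in $v$, and the set $\mathrm{NF}(X)$ consisting of all letters $x\in X$ (of length $1$) and all $[u;v]$ (of length $p+q$) is a linear basis of $\mathrm{BC}(X)$ that is closed under multiplication. Fix a monomial order on $\mathrm{NF}(X)$, i.e. a well order $<$ such that $\mu<\nu$ implies $\mu\rho<\nu\rho$ and $\rho\mu<\rho\nu$ for all $\mu,\nu,\rho\in\mathrm{NF}(X)$. For nonzero $f\in\mathrm{BC}(X)$ let $\bar f$ be the largest element of $\mathrm{NF}(X)$ that occurs in $f$ with nonzero coefficient; $f$ is monic if this coefficient is $1$. For a set $S$ of monic elements, the normal $S$-polynomials are the elements $s\in S$ and, for those $s\in S$ for which $\bar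 s$ has length at least $2$, also all elements $z_1(z_2(\cdots(z_p((\cdots((sy_1)y_2)\cdots)y_q))\cdots))$ with $p,q\ge 0$ and $z_i,y_j\in X$. Such a set $S$ is a Gröbner–Shirshov basis for $\mathrm{BC}(X)/I$, where $I$ is a (two-sided) ideal, if $S$ generates $I$ as an ideal and for every nonzero $f\in I$ there is a normal $S$-polynomial $h$ with $\bar f=\bar h$. Theorem. For every ideal $I$ of $\mathrm{BC}(X)$ there exists a finite Gröbner–Shirshov basis for $\mathrm{BC}(X)/I$. -/

import Mathlib

noncomputable section

/-! ### Bicommutative algebras and bracketings -/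

/-- A (not necessarily associative) multiplication is bicommutative if it satisfies
`x(yz) = y(xz)` and `(xy)z = (xz)y`. -/
class IsBicommutative (A : Type*) [Mul A] : Prop where
  left_comm : ∀ x y z : A, x * (y * z) = y * (x * z)
  right_comm : ∀ x y z : A, (x * y) * z = (x * z) * y

/-- Right-normed bracketing `(a₁ (a₂ ⋯ (aₙ b) ⋯ ))`; it is `b` if the list is empty. -/
def rnormed {A : Type*} [Mul A] (as : List A) (b : A) : A := as.foldr (fun a c => a * c) b

/-- Left-normed bracketing `( ⋯ ((a b₁) b₂) ⋯ bₙ)`; it is `a` if the list is empty. -/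
def lnormed {A : Type*} [Mul A] (a : A) (bs : List A) : A := bs.foldl (fun c b => c * b) a

/-- The monomial `[a₁⋯aₚ;b₁⋯b_q] = (a₁ ⋯ (aₚ₋₁ ( ⋯ (aₚ b₁) ⋯ b_q)) ⋯ )`. -/
def bracket {A : Type*} [Mul A] (as bs : List A) (has : as ≠ []) : A :=
  rnormed as.dropLast (lnormed (as.getLast has) bs)

namespace IsBicommutative

theorem mul_bracket {A : Type*} [Mul A] (a : A) (as bs : List A) (has : as ≠ []) :
    a * bracket as bs has = bracket (a :: as) bs (by simp) := by
  unfold bracket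
  rw [List.dropLast_cons_of_ne_nil has, List.getLast_cons has]
  rfl

variable {A : Type*} [Mul A] [IsBicommutative A]

theorem mul_assoc_mid (a b c d : A) : (a * (b * c)) * d = a * ((b * c) * d) := by
  have h1 : (a * (b * c)) * d = b * ((a * c) * d) := by
    rw [right_comm a (b * c) d, left_comm (a * d) b c, right_comm a d c]
  have h2 : a * ((b * c) * d) = (b * (a * c)) * d := by
    rw [right_comm b c d, left_comm a (b * d) c, right_comm b d (a * c)]
  rw [h2, left_comm b a c, h1, right_comm a c d]

theorem mul_lnormed_mul (a b c : A) (l : List A) :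
    a * lnormed (b * c) l = lnormed (a * (b * c)) l := by
  induction l generalizing b c with
  | nil => rfl
  | cons d l ih =>
    simp only [lnormed, List.foldl_cons] at ih ⊢
    rw [ih (b * c) d, mul_assoc_mid]

theorem rnormed_perm {l l' : List A} (h : l.Perm l') (b : A) : rnormed l b = rnormed l' b := by
  induction h with
  | nil => rfl
  | cons x _ ih => simp only [rnormed, List.foldr_cons] at ih ⊢; rw [ih]
  | swap x y l => simp only [rnormed, List.foldr_cons]; rw [left_comm]
  | trans _ _ ih ih' => exact ih.trans ih'

theorem lnormed_perm {l l' : List A} (h : l.Perm l') (a : A) : lnormed a l = lnormed a l' := by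
  induction h generalizing a with
  | nil => rfl
  | cons x _ ih => exact ih (a * x)
  | swap x y l => simp only [lnormed, List.foldl_cons]; rw [right_comm]
  | trans _ _ ih ih' => exact (ih a).trans (ih' a)

/-- `(a₁ ⋯ (aₚ₋₁ ( ⋯ (aₚ b₁) ⋯ b_q)) ⋯ )` equals `( ⋯ (a₁ ⋯ (aₚ b₁) ⋯ ) ⋯ b_q)`. -/
theorem rnormed_lnormed (zs : List A) (z y : A) (ys : List A) :
    rnormed zs (lnormed z (y :: ys)) = lnormed (rnormed (zs ++ [z]) y) ys := by
  have key : ∀ zs : List A, ∃ b c, rnormed (zs ++ [z]) y = b * c := by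
    intro zs
    cases zs with
    | nil => exact ⟨z, y, rfl⟩
    | cons w zs => exact ⟨w, rnormed (zs ++ [z]) y, rfl⟩
  induction zs with
  | nil => rfl
  | cons w zs ih =>
    obtain ⟨b, c, h⟩ := key zs
    have e1 : rnormed (w :: zs) (lnormed z (y :: ys)) =
        w * rnormed zs (lnormed z (y :: ys)) := rfl
    have e2 : rnormed (w :: zs ++ [z]) y = w * rnormed (zs ++ [z]) y := rfl
    rw [e1, e2, ih, h, mul_lnormed_mul]

theorem bracket_eq (as : List A) (has : as ≠ []) (y : A) (ys : List A) :
    bracket as (y :: ys) has = lnormed (rnormed as y) ys := by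
  unfold bracket
  rw [rnormed_lnormed, List.dropLast_append_getLast has]

theorem bracket_perm {as as' bs bs' : List A} (has : as ≠ []) (has' : as' ≠ []) (hbs : bs ≠ [])
    (h : as.Perm as') (h' : bs.Perm bs') : bracket as bs has = bracket as' bs' has' := by
  have e : bracket as bs has = bracket as' bs has' := by
    obtain ⟨y, ys, rfl⟩ := List.exists_cons_of_ne_nil hbs
    rw [bracket_eq, bracket_eq, rnormed_perm h]
  rw [e]
  unfold bracket
  rw [lnormed_perm h']

theorem bracket_mul (as bs : List A) (has : as ≠ []) (hbs : bs ≠ []) (b : A) :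
    bracket as bs has * b = bracket as (bs ++ [b]) has := by
  obtain ⟨y, ys, rfl⟩ := List.exists_cons_of_ne_nil hbs
  rw [List.cons_append, bracket_eq, bracket_eq]
  simp [lnormed]

theorem mul_bracket_left (a : A) (as bs : List A) (has : as ≠ []) (hbs : bs ≠ []) :
    a * bracket as bs has = rnormed as (lnormed a bs) := by
  obtain ⟨y, ys, rfl⟩ := List.exists_cons_of_ne_nil hbs
  have h1 : ∀ (l : List A) (d : A), a * rnormed l d = rnormed l (a * d) := by
    intro l d
    induction l with
    | nil => rfl
    | cons w l ih =>
      simp only [rnormed, List.foldr_cons] at ih ⊢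
      rw [left_comm, ih]
  rw [bracket_eq]
  have h2 : ∃ d, rnormed as y = as.head has * d := by
    cases as with
    | nil => exact absurd rfl has
    | cons w l => exact ⟨rnormed l y, rfl⟩
  obtain ⟨d, hd⟩ := h2
  have h3 : ∀ (l : List A), l ≠ [] → ∀ ys : List A,
      rnormed l (lnormed (a * y) ys) = lnormed (rnormed l (a * y)) ys := by
    intro l _ ys
    have h4 : ∀ l : List A, ∃ e f, rnormed l (a * y) = e * f := by
      intro l
      cases l with
      | nil => exact ⟨a, y, rfl⟩
      | cons w l => exact ⟨w, rnormed l (a * y), rfl⟩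
    clear * - h4
    induction l with
    | nil => rfl
    | cons w l ih =>
      obtain ⟨e, f, h⟩ := h4 l
      have e1 : ∀ d, rnormed (w :: l) d = w * rnormed l d := fun _ => rfl
      rw [e1, e1, ih, h, mul_lnormed_mul]
  rw [hd, mul_lnormed_mul, ← hd, h1]
  exact (h3 as has ys).symm

theorem bracket_mul_bracket (as bs as' bs' : List A) (has : as ≠ []) (hbs : bs ≠ [])
    (has' : as' ≠ []) (hbs' : bs' ≠ []) :
    bracket as bs has * bracket as' bs' has' =
      bracket (as' ++ as) (bs ++ bs') (by simp [has]) := by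
  rw [mul_bracket_left _ as' bs' has' hbs']
  unfold bracket
  rw [List.dropLast_append_of_ne_nil has, List.getLast_append_of_ne_nil _ has]
  obtain ⟨y, ys, rfl⟩ := List.exists_cons_of_ne_nil hbs
  have h3 : lnormed (rnormed as.dropLast (lnormed (as.getLast has) (y :: ys))) bs' =
      rnormed as.dropLast (lnormed (as.getLast has) (y :: ys ++ bs')) := by
    rw [List.cons_append, rnormed_lnormed, rnormed_lnormed]
    simp [lnormed]
  rw [h3]
  simp [rnormed]

end IsBicommutative

/-! ### The free bicommutative algebra -/

section Free

variable (k : Type*) [Field k] (X : Type*)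

/-- The quotient of the free nonassociative algebra by the equivalence relation generated by this
relation is the free bicommutative algebra. -/
inductive BicommRel :
    FreeNonUnitalNonAssocAlgebra k X → FreeNonUnitalNonAssocAlgebra k X → Prop
  | left_comm (a b c : FreeNonUnitalNonAssocAlgebra k X) :
      BicommRel (a * (b * c)) (b * (a * c))
  | right_comm (a b c : FreeNonUnitalNonAssocAlgebra k X) :
      BicommRel ((a * b) * c) ((a * c) * b)
  | smul (t : k) {a b : FreeNonUnitalNonAssocAlgebra k X} :
      BicommRel a b → BicommRel (t • a) (t • b)
  | add_right {a b : FreeNonUnitalNonAssocAlgebra k X} (c : FreeNonUnitalNonAssocAlgebra k X) :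
      BicommRel a b → BicommRel (a + c) (b + c)
  | mul_left (a : FreeNonUnitalNonAssocAlgebra k X) {b c : FreeNonUnitalNonAssocAlgebra k X} :
      BicommRel b c → BicommRel (a * b) (a * c)
  | mul_right {a b : FreeNonUnitalNonAssocAlgebra k X} (c : FreeNonUnitalNonAssocAlgebra k X) :
      BicommRel a b → BicommRel (a * c) (b * c)

/-- The free bicommutative algebra `BC(X)` over the field `k`. -/
def BC : Type _ := Quot (BicommRel k X)

namespace BC

variable {k X}

theorem rel_add_left (a : FreeNonUnitalNonAssocAlgebra k X)
    {b c : FreeNonUnitalNonAssocAlgebra k X} (h : BicommRel k X b c) :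
    BicommRel k X (a + b) (a + c) := by
  rw [add_comm a b, add_comm a c]; exact h.add_right _

theorem rel_neg {a b : FreeNonUnitalNonAssocAlgebra k X} (h : BicommRel k X a b) :
    BicommRel k X (-a) (-b) := by
  simpa only [neg_one_smul] using h.smul (-1)

theorem rel_sub_left (a : FreeNonUnitalNonAssocAlgebra k X)
    {b c : FreeNonUnitalNonAssocAlgebra k X} (h : BicommRel k X b c) :
    BicommRel k X (a - b) (a - c) := by
  simpa only [sub_eq_add_neg] using rel_add_left a (rel_neg h)

theorem rel_sub_right {a b : FreeNonUnitalNonAssocAlgebra k X}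
    (c : FreeNonUnitalNonAssocAlgebra k X) (h : BicommRel k X a b) :
    BicommRel k X (a - c) (b - c) := by
  simpa only [sub_eq_add_neg] using h.add_right (-c)

instance : Zero (BC k X) where zero := Quot.mk _ 0

instance : Add (BC k X) where
  add := Quot.map₂ (fun a b => a + b) (fun _ _ _ => rel_add_left _)
    fun _ _ _ => BicommRel.add_right _

instance : Neg (BC k X) where neg := Quot.map (fun a => -a) fun _ _ => rel_neg

instance : Sub (BC k X) where
  sub := Quot.map₂ (fun a b => a - b) (fun _ _ _ => rel_sub_left _)
    fun _ _ _ => rel_sub_right _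

instance : Mul (BC k X) where
  mul := Quot.map₂ (fun a b => a * b) (fun _ _ _ => BicommRel.mul_left _)
    fun _ _ _ => BicommRel.mul_right _

instance instSMulBC {S : Type*} [Monoid S] [DistribMulAction S k] [IsScalarTower S k k] :
    SMul S (BC k X) where
  smul t := Quot.map (fun a => t • a) (fun a b h => by
    rw [← smul_one_smul k t a, ← smul_one_smul k t b]; exact h.smul _)

instance instAddGroupBC : AddGroup (BC k X) :=
  Function.Surjective.addGroup (Quot.mk _) Quot.mk_surjective rfl (fun _ _ => rfl)
    (fun _ => rfl) (fun _ _ => rfl) (fun _ _ => rfl) fun _ _ => rfl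

instance instRingBC : NonUnitalNonAssocRing (BC k X) where
  add_comm := by rintro ⟨a⟩ ⟨b⟩; exact congrArg (Quot.mk _) (add_comm a b)
  left_distrib := by rintro ⟨a⟩ ⟨b⟩ ⟨c⟩; exact congrArg (Quot.mk _) (mul_add a b c)
  right_distrib := by rintro ⟨a⟩ ⟨b⟩ ⟨c⟩; exact congrArg (Quot.mk _) (add_mul a b c)
  zero_mul := by rintro ⟨a⟩; exact congrArg (Quot.mk _) (zero_mul a)
  mul_zero := by rintro ⟨a⟩; exact congrArg (Quot.mk _) (mul_zero a)

instance instModuleBC : Module k (BC k X) :=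
  Function.Surjective.module k ⟨⟨Quot.mk (BicommRel k X), rfl⟩, fun _ _ => rfl⟩
    Quot.mk_surjective (fun _ _ => rfl)

instance : IsScalarTower k (BC k X) (BC k X) where
  smul_assoc := by rintro t ⟨a⟩ ⟨b⟩; exact congrArg (Quot.mk _) (smul_mul_assoc t a b)

instance : SMulCommClass k (BC k X) (BC k X) where
  smul_comm := by rintro t ⟨a⟩ ⟨b⟩; exact congrArg (Quot.mk _) (mul_smul_comm t a b).symm

instance : IsBicommutative (BC k X) where
  left_comm := by rintro ⟨a⟩ ⟨b⟩ ⟨c⟩; exact Quot.sound (BicommRel.left_comm a b c)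
  right_comm := by rintro ⟨a⟩ ⟨b⟩ ⟨c⟩; exact Quot.sound (BicommRel.right_comm a b c)

variable (k) in
/-- The generator of `BC(X)` given by a letter. -/
def of (x : X) : BC k X := Quot.mk _ (FreeNonUnitalNonAssocAlgebra.of k x)

/-- The quotient map from the free nonassociative algebra. -/
def proj : FreeNonUnitalNonAssocAlgebra k X →ₙₐ[k] BC k X where
  toFun := Quot.mk _
  map_smul' _ _ := rfl
  map_zero' := rfl
  map_add' _ _ := rfl
  map_mul' _ _ := rfl

section UniversalProperty

variable {B : Type*} [NonUnitalNonAssocRing B] [Module k B] [IsScalarTower k B B]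
  [SMulCommClass k B B] [IsBicommutative B]

theorem lift_rel (f : X → B) (a b : FreeNonUnitalNonAssocAlgebra k X) (h : BicommRel k X a b) :
    FreeNonUnitalNonAssocAlgebra.lift k f a = FreeNonUnitalNonAssocAlgebra.lift k f b := by
  induction h with
  | left_comm a b c => simp only [map_mul]; exact IsBicommutative.left_comm _ _ _
  | right_comm a b c => simp only [map_mul]; exact IsBicommutative.right_comm _ _ _
  | smul t _ h => simp only [map_smul, h]
  | add_right c _ h => simp only [map_add, h]
  | mul_left a _ h => simp only [map_mul, h]
  | mul_right c _ h => simp only [map_mul, h]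

variable (k) in
/-- The universal property: a map from `X` to a bicommutative algebra extends to `BC(X)`. -/
def lift (f : X → B) : BC k X →ₙₐ[k] B where
  toFun c := Quot.liftOn c (FreeNonUnitalNonAssocAlgebra.lift k f) (lift_rel f)
  map_smul' := by rintro t ⟨a⟩; exact map_smul (FreeNonUnitalNonAssocAlgebra.lift k f) t a
  map_zero' := map_zero (FreeNonUnitalNonAssocAlgebra.lift k f)
  map_add' := by rintro ⟨a⟩ ⟨b⟩; exact map_add (FreeNonUnitalNonAssocAlgebra.lift k f) a b
  map_mul' := by rintro ⟨a⟩ ⟨b⟩; exact map_mul (FreeNonUnitalNonAssocAlgebra.lift k f) a b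

theorem lift_of (f : X → B) (x : X) : lift k f (of k x) = f x :=
  FreeNonUnitalNonAssocAlgebra.lift_of_apply k f x

end UniversalProperty

theorem hom_ext {B : Type*} [NonUnitalNonAssocRing B] [Module k B] [IsScalarTower k B B]
    [SMulCommClass k B B] {F G : BC k X →ₙₐ[k] B} (h : ∀ x, F (of k x) = G (of k x)) : F = G := by
  have h' : F.comp proj = G.comp proj := FreeNonUnitalNonAssocAlgebra.hom_ext k h
  ext ⟨a⟩
  exact DFunLike.congr_fun h' a

end BC

end Free

/-! ### Normal monomials -/

/-- The set `NF(X)`: the letters `x ∈ X`, and the symbols `[u;v]` where `u` and `v` are nonempty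
commutative words over `X`, a commutative word being a multiset of letters. -/
inductive NF (X : Type*) : Type _
  | letter (x : X) : NF X
  | pair (u v : Multiset X) (hu : u ≠ 0) (hv : v ≠ 0) : NF X

namespace NF

variable {X : Type*}

/-- The length: the number of letters, counted with repetition. -/
def length : NF X → ℕ
  | letter _ => 1
  | pair u v _ _ => u.card + v.card


/-- The multiplication table of `NF(X)`: `zy = [z;y]`, `z[u;v] = [zu;v]`, `[u;v]z = [u;vz]` and
`[u;v][u';v'] = [uu';vv']`. It is the one of `BC(X)`, see `BC.monomial_mul`. -/
def mul : NF X → NF X → NF X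
  | letter z, letter y => pair {z} {y} (by simp) (by simp)
  | letter z, pair u v _ hv => pair (z ::ₘ u) v (by simp) hv
  | pair u v hu _, letter z => pair u (z ::ₘ v) hu (by simp)
  | pair u v hu hv, pair u' v' _ _ =>
      pair (u + u') (v + v') (by simp [hu]) (by simp [hv])

instance : Mul (NF X) := ⟨mul⟩

instance : IsBicommutative (NF X) where
  left_comm := by
    rintro (x | ⟨u, v, hu, hv⟩) (y | ⟨u', v', hu', hv'⟩) (z | ⟨u'', v'', hu'', hv''⟩) <;>
      simp only [HMul.hMul, Mul.mul, mul, pair.injEq, ← Multiset.singleton_add] <;>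
      constructor <;> first | trivial | rfl | ac_rfl
  right_comm := by
    rintro (x | ⟨u, v, hu, hv⟩) (y | ⟨u', v', hu', hv'⟩) (z | ⟨u'', v'', hu'', hv''⟩) <;>
      simp only [HMul.hMul, Mul.mul, mul, pair.injEq, ← Multiset.singleton_add] <;>
      constructor <;> first | trivial | rfl | ac_rfl

end NF

namespace BC

variable (k : Type*) [Field k] {X : Type*}

/-- The element of `BC(X)` denoted by a normal monomial. The letters of `u` and `v` are listed in
some order, which does not matter by `BC.monomial_pair`. -/
def monomial : NF X → BC k X
  | .letter x => of k x
  | .pair u v hu _ => bracket (u.toList.map (of k)) (v.toList.map (of k)) (by simpa using hu)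

theorem monomial_pair (us vs : List X) (hu : (us : Multiset X) ≠ 0) (hv : (vs : Multiset X) ≠ 0)
    (h : us.map (of k) ≠ []) :
    monomial k (.pair us vs hu hv) = bracket (us.map (of k)) (vs.map (of k)) h := by
  refine IsBicommutative.bracket_perm _ _ (by simpa using hv) ?_ ?_
  · exact List.Perm.map _ (Multiset.coe_eq_coe.1 (by simp))
  · exact List.Perm.map _ (Multiset.coe_eq_coe.1 (by simp))

theorem monomial_mul (μ ν : NF X) : monomial k (μ * ν) = monomial k μ * monomial k ν := by
  rcases μ with z | ⟨u, v, hu, hv⟩ <;> rcases ν with y | ⟨u', v', hu', hv'⟩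
  · exact monomial_pair k [z] [y] (by simp) (by simp) (by simp)
  · obtain ⟨us, rfl⟩ : ∃ l : List X, u' = l := ⟨_, (u').coe_toList.symm⟩
    obtain ⟨vs, rfl⟩ : ∃ l : List X, v' = l := ⟨_, (v').coe_toList.symm⟩
    change monomial k (.pair ((z :: us : List X) : Multiset X) (vs : Multiset X) (by simp) hv') =
      of k z * monomial k (.pair (us : Multiset X) (vs : Multiset X) _ _)
    have hus : us ≠ [] := by rintro rfl; exact hu' rfl
    rw [monomial_pair k (z :: us) vs _ _ (by simp), monomial_pair k us vs _ _ (by simpa using hus),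
      IsBicommutative.mul_bracket]
    rfl
  · obtain ⟨us, rfl⟩ : ∃ l : List X, u = l := ⟨_, (u).coe_toList.symm⟩
    obtain ⟨vs, rfl⟩ : ∃ l : List X, v = l := ⟨_, (v).coe_toList.symm⟩
    change monomial k (.pair (us : Multiset X) ((y :: vs : List X) : Multiset X) hu (by simp)) =
      monomial k (.pair (us : Multiset X) (vs : Multiset X) _ _) * of k y
    have hus : us ≠ [] := by rintro rfl; exact hu rfl
    have hvs : vs ≠ [] := by rintro rfl; exact hv rfl
    rw [monomial_pair k _ _ _ _ (by simpa using hus), monomial_pair k _ _ _ _ (by simpa using hus),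
      IsBicommutative.bracket_mul _ _ _ (by simpa using hvs)]
    exact IsBicommutative.bracket_perm _ _ (by simp) (List.Perm.refl _)
      (List.perm_append_singleton _ _).symm
  · obtain ⟨us, rfl⟩ : ∃ l : List X, u = l := ⟨_, (u).coe_toList.symm⟩
    obtain ⟨vs, rfl⟩ : ∃ l : List X, v = l := ⟨_, (v).coe_toList.symm⟩
    obtain ⟨us', rfl⟩ : ∃ l : List X, u' = l := ⟨_, (u').coe_toList.symm⟩
    obtain ⟨vs', rfl⟩ : ∃ l : List X, v' = l := ⟨_, (v').coe_toList.symm⟩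
    have hus : us ≠ [] := by rintro rfl; exact hu rfl
    have hvs : vs ≠ [] := by rintro rfl; exact hv rfl
    have hus2 : ((us ++ us' : List X) : Multiset X) ≠ 0 := by simp [hus]
    have hvs2 : ((vs ++ vs' : List X) : Multiset X) ≠ 0 := by simp [hvs]
    change monomial k (.pair ((us ++ us' : List X) : Multiset X)
        ((vs ++ vs' : List X) : Multiset X) hus2 hvs2) =
      monomial k (.pair (us : Multiset X) (vs : Multiset X) _ _) *
        monomial k (.pair (us' : Multiset X) (vs' : Multiset X) _ _)
    have hus' : us' ≠ [] := by rintro rfl; exact hu' rfl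
    have hvs' : vs' ≠ [] := by rintro rfl; exact hv' rfl
    rw [monomial_pair k _ _ _ _ (by simp [hus]), monomial_pair k us vs _ _ (by simpa using hus),
      monomial_pair k _ _ _ _ (by simpa using hus'),
      IsBicommutative.bracket_mul_bracket _ _ _ _ _ (by simpa using hvs) _ (by simpa using hvs')]
    refine IsBicommutative.bracket_perm _ _ (by simp [hvs]) ?_ (by simp)
    simpa using List.perm_append_comm

instance : IsBicommutative (MonoidAlgebra k (NF X)) where
  left_comm a b c := by
    induction a using MonoidAlgebra.induction_linear with
    | zero => simp
    | add a a' h h' => simp only [add_mul, mul_add, h, h']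
    | single x r =>
    induction b using MonoidAlgebra.induction_linear with
    | zero => simp
    | add b b' h h' => simp only [add_mul, mul_add, h, h']
    | single y s =>
    induction c using MonoidAlgebra.induction_linear with
    | zero => simp
    | add c c' h h' => simp only [mul_add, h, h']
    | single z t =>
      simp only [MonoidAlgebra.single_mul_single]
      rw [IsBicommutative.left_comm x y z, mul_left_comm r s t]
  right_comm a b c := by
    induction a using MonoidAlgebra.induction_linear with
    | zero => simp
    | add a a' h h' => simp only [add_mul, h, h']
    | single x r =>
    induction b using MonoidAlgebra.induction_linear with
    | zero => simp
    | add b b' h h' => simp only [add_mul, mul_add, h, h']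
    | single y s =>
    induction c using MonoidAlgebra.induction_linear with
    | zero => simp
    | add c c' h h' => simp only [add_mul, mul_add, h, h']
    | single z t =>
      simp only [MonoidAlgebra.single_mul_single]
      rw [IsBicommutative.right_comm x y z, mul_right_comm r s t]

theorem map_bracket {A B F : Type*} [Mul A] [Mul B] [FunLike F A B] [MulHomClass F A B] (f : F)
    (as bs : List A) (has : as ≠ []) :
    f (bracket as bs has) = bracket (as.map f) (bs.map f) (by simpa using has) := by
  have h1 : ∀ (l : List A) (a : A), f (lnormed a l) = lnormed (f a) (l.map f) := by
    intro l
    induction l with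
    | nil => intro a; rfl
    | cons b l ih =>
      intro a
      have := ih (a * b)
      rw [map_mul] at this
      exact this
  have h2 : ∀ (l : List A) (a : A), f (rnormed l a) = rnormed (l.map f) (f a) := by
    intro l a
    induction l with
    | nil => rfl
    | cons b l ih =>
      simp only [rnormed, List.foldr_cons, List.map_cons, map_mul] at ih ⊢
      rw [ih]
  unfold bracket
  rw [h2, h1, List.map_dropLast, List.getLast_map]

theorem bracket_letter (us vs : List X) (hu : (us : Multiset X) ≠ 0) (hv : (vs : Multiset X) ≠ 0)
    (h : us.map NF.letter ≠ []) :
    bracket (us.map NF.letter) (vs.map NF.letter) h = NF.pair us vs hu hv := by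
  obtain ⟨y, ys, rfl⟩ := List.exists_cons_of_ne_nil (fun e : vs = [] => hv (by simp [e]))
  rw [List.map_cons, IsBicommutative.bracket_eq]
  have h1 : ∀ (us : List X) (hu : (us : Multiset X) ≠ 0),
      rnormed (us.map NF.letter) (NF.letter y) = NF.pair us {y} hu (by simp) := by
    intro us
    induction us with
    | nil => intro hu; exact absurd rfl hu
    | cons u us ih =>
      intro _
      rcases us with _ | ⟨w, us⟩
      · rfl
      · have e : rnormed ((u :: w :: us).map NF.letter) (NF.letter y) =
            NF.letter u * rnormed ((w :: us).map NF.letter) (NF.letter y) := rfl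
        rw [e, ih (by simp)]
        rfl
  have h2 : ∀ (ys : List X) (u v : Multiset X) (hu : u ≠ 0) (hv : v ≠ 0),
      lnormed (NF.pair u v hu hv) (ys.map NF.letter) =
        NF.pair u (v + ys) hu (by simp [hv]) := by
    intro ys
    induction ys with
    | nil => intro u v hu hv; simp [lnormed]
    | cons w ys ih =>
      intro u v hu hv
      have e : lnormed (NF.pair u v hu hv) ((w :: ys).map NF.letter) =
        lnormed (NF.pair u (w ::ₘ v) hu (by simp)) (ys.map NF.letter) := rfl
      rw [e, ih]
      simp only [NF.pair.injEq, true_and]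
      rw [← Multiset.cons_coe, Multiset.cons_add, Multiset.add_cons]
  rw [h1 us hu, h2]
  simp only [NF.pair.injEq, true_and]
  rw [← Multiset.cons_coe, Multiset.singleton_add]

/-- The coordinates of an element of `BC(X)` with respect to the normal monomials. -/
def toNF : BC k X →ₙₐ[k] MonoidAlgebra k (NF X) :=
  lift k fun x => MonoidAlgebra.single (NF.letter x) 1

/-- The linear combination of normal monomials with given coefficients. -/
def ofNF : MonoidAlgebra k (NF X) →ₙₐ[k] BC k X :=
  MonoidAlgebra.liftMagma k ⟨monomial k, monomial_mul k⟩

theorem ofNF_single (μ : NF X) : ofNF k (MonoidAlgebra.single μ 1) = monomial k μ := by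
  simp [ofNF]

theorem toNF_monomial (μ : NF X) : toNF k (monomial k μ) = MonoidAlgebra.single μ 1 := by
  rcases μ with x | ⟨u, v, hu, hv⟩
  · exact lift_of _ x
  · obtain ⟨us, rfl⟩ : ∃ l : List X, u = l := ⟨_, (u).coe_toList.symm⟩
    obtain ⟨vs, rfl⟩ : ∃ l : List X, v = l := ⟨_, (v).coe_toList.symm⟩
    have hus : us ≠ [] := by rintro rfl; exact hu rfl
    change toNF k (monomial k (.pair (us : Multiset X) (vs : Multiset X) _ _)) =
      MonoidAlgebra.ofMagma k (NF X) (.pair (us : Multiset X) (vs : Multiset X) _ _)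
    rw [monomial_pair k _ _ _ _ (by simpa using hus), map_bracket,
      ← bracket_letter us vs hu hv (by simpa using hus), map_bracket]
    have e : ∀ l : List X, (l.map (of k)).map (toNF k) =
        (l.map NF.letter).map (MonoidAlgebra.ofMagma k (NF X)) := by
      intro l
      rw [List.map_map, List.map_map]
      refine List.map_congr_left fun x _ => ?_
      exact lift_of _ x
    congr 1 <;> exact e _

theorem ofNF_toNF (f : BC k X) : ofNF k (toNF k f) = f := by
  have h : (ofNF k).comp (toNF k) = NonUnitalAlgHom.id k (BC k X) := by
    refine hom_ext fun x => ?_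
    change ofNF k (toNF k (monomial k (.letter x))) = monomial k (.letter x)
    rw [toNF_monomial, ofNF_single]
  exact DFunLike.congr_fun h f

theorem toNF_ofNF (f : MonoidAlgebra k (NF X)) : toNF k (ofNF k f) = f := by
  have h : (toNF k).comp (ofNF k) = NonUnitalAlgHom.id k (MonoidAlgebra k (NF X)) := by
    refine MonoidAlgebra.nonUnitalAlgHom_ext k fun μ => ?_
    change toNF k (ofNF k (MonoidAlgebra.single μ 1)) = MonoidAlgebra.single μ 1
    rw [ofNF_single, toNF_monomial]
  exact DFunLike.congr_fun h f

/-- The normal monomials form a linear basis of `BC(X)`. -/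
def normalBasis : Module.Basis (NF X) k (BC k X) :=
  .ofRepr
    { toFun := fun f => (toNF k f).coeff
      invFun := fun c => ofNF k (.ofCoeff c)
      map_add' := fun f g => by rw [map_add, MonoidAlgebra.coeff_add]
      map_smul' := fun t f => by
        rw [map_smul, MonoidAlgebra.coeff_smul, RingHom.id_apply]
      left_inv := fun f => ofNF_toNF k f
      right_inv := fun c => congrArg MonoidAlgebra.coeff (toNF_ofNF k (.ofCoeff c)) }

theorem normalBasis_apply (μ : NF X) : normalBasis k μ = monomial k μ := by
  rw [normalBasis, Module.Basis.coe_ofRepr]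
  exact ofNF_single k μ

end BC

/-! ### Monomial orders, ideals and Gröbner–Shirshov bases -/

/-- A monomial order on `NF(X)`: a well order such that `μ < ν` implies `μρ < νρ` and `ρμ < ρν`,
where the product of two normal monomials is the one in `BC(X)`. -/
structure IsMonomialOrder {X : Type*} (lt : NF X → NF X → Prop) : Prop where
  isWellOrder : IsWellOrder (NF X) lt
  mul_right : ∀ μ ν ρ : NF X, lt μ ν → lt (μ * ρ) (ν * ρ)
  mul_left : ∀ μ ν ρ : NF X, lt μ ν → lt (ρ * μ) (ρ * ν)

/-- A two-sided ideal of a nonassociative algebra. -/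
def IsAlgIdeal {k A : Type*} [Field k] [NonUnitalNonAssocRing A] [Module k A]
    (I : Submodule k A) : Prop :=
  ∀ a : A, ∀ f ∈ I, a * f ∈ I ∧ f * a ∈ I

/-- The two-sided ideal `Id(S)` generated by a set. -/
def idealSpan (k : Type*) {A : Type*} [Field k] [NonUnitalNonAssocRing A] [Module k A]
    (S : Set A) : Submodule k A :=
  sInf {J | IsAlgIdeal J ∧ S ⊆ (J : Set A)}

theorem isAlgIdeal_idealSpan (k : Type*) {A : Type*} [Field k] [NonUnitalNonAssocRing A]
    [Module k A] (S : Set A) : IsAlgIdeal (idealSpan k S) := by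
  intro a f hf
  simp only [idealSpan, Submodule.mem_sInf] at hf ⊢
  exact ⟨fun J hJ => (hJ.1 a f (hf J hJ)).1, fun J hJ => (hJ.1 a f (hf J hJ)).2⟩

section GroebnerShirshov

variable {k : Type*} [Field k] {X : Type*}

/-- `μ` is the leading monomial of `f`: the largest normal monomial with a nonzero coefficient
in `f`. The polynomial `0` has no leading monomial. -/
def IsLeadingMonomial (lt : NF X → NF X → Prop) (f : BC k X) (μ : NF X) : Prop :=
  (BC.normalBasis k).repr f μ ≠ 0 ∧
    ∀ ν : NF X, (BC.normalBasis k).repr f ν ≠ 0 → ν ≠ μ → lt ν μ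

/-- A monic polynomial: it is nonzero and its leading coefficient is `1`. -/
def IsMonicPoly (lt : NF X → NF X → Prop) (f : BC k X) : Prop :=
  ∃ μ : NF X, IsLeadingMonomial lt f μ ∧ (BC.normalBasis k).repr f μ = 1

/-- The normal `S`-polynomials: the elements `s ∈ S`, and for `s ∈ S` with leading monomial of
length at least two also `(z₁ ⋯ (zₚ ( ⋯ (s y₁) ⋯ y_q)) ⋯ )`, where `p, q ≥ 0` and the `zᵢ` and
`yⱼ` are letters. -/
inductive IsNormalPoly (lt : NF X → NF X → Prop) (S : Set (BC k X)) : BC k X → Prop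
  | base (s : BC k X) (hs : s ∈ S) : IsNormalPoly lt S s
  | bracketed (s : BC k X) (hs : s ∈ S) (μ : NF X) (hμ : IsLeadingMonomial lt s μ)
      (hl : 2 ≤ μ.length) (zs ys : List X) :
      IsNormalPoly lt S (rnormed (zs.map (BC.of k)) (lnormed s (ys.map (BC.of k))))

/-- `S` is a Gröbner–Shirshov basis for `BC(X)/I`: it is a monic set generating the ideal `I`, and
every nonzero element of `Id(S)` has the same leading monomial as some normal `S`-polynomial. -/
structure IsGroebnerShirshovBasis (lt : NF X → NF X → Prop) (S : Set (BC k X))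
    (I : Submodule k (BC k X)) : Prop where
  monic : ∀ s ∈ S, IsMonicPoly lt s
  span_eq : idealSpan k S = I
  leading : ∀ f ∈ idealSpan k S, f ≠ 0 → ∃ (h : BC k X) (μ : NF X),
    IsNormalPoly lt S h ∧ IsLeadingMonomial lt f μ ∧ IsLeadingMonomial lt h μ

end GroebnerShirshov

end

/-! ### Dickson's lemma for commutative words -/

/-! The argument is the commutative one, run in two sets of variables at once. A normal monomial of
length at least two is a pair `(u, v)` of commutative words. Multiplying by a letter on the left
enlarges `u`, and on the right enlarges `v`, so componentwise divisibility of pairs is realised by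
bracketing with letters. Since the order is monomial, such bracketing moves leading monomials in the
same way (`leadingMonomial_lnormed`, `leadingMonomial_rnormed`).

Take the pairs that are leading monomials of elements of `I`. By Dickson's lemma only finitely many
are minimal, and every other one is a multiple of a minimal one. Letters are not pairs, but there
are only finitely many of them. Choosing a monic element of `I` for each minimal pair and for each
letter that leads an element of `I` gives a finite `S` whose normal polynomials realise every
leading monomial of `I`.

That `S` also generates `I` follows by division: subtracting a multiple of a normal polynomial
lowers the leading monomial, and the order is well-founded (`isGroebnerShirshovBasis_of_leading`).
-/

instance Multiset.wellQuasiOrderedLE {X : Type*} [Finite X] : WellQuasiOrderedLE (Multiset X) := by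
  classical
  -- Counting multiplicities turns inclusion of multisets into the pointwise order on `X →₀ ℕ`, a
  -- well-quasi-order because `X` is finite.
  exact (Finsupp.orderIsoMultiset (ι := X)).symm.wellQuasiOrderedLE_iff.2 inferInstance

/-! ### Strict total order properties of a monomial order -/

namespace IsMonomialOrder

variable {k : Type*} [Field k] {X : Type*} {lt : NF X → NF X → Prop}

theorem trichotomy (hlt : IsMonomialOrder lt) (μ ν : NF X) : lt μ ν ∨ μ = ν ∨ lt ν μ :=
  haveI := hlt.isWellOrder
  trichotomous_of lt μ ν

theorem irrefl (hlt : IsMonomialOrder lt) (μ : NF X) : ¬ lt μ μ :=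
  haveI := hlt.isWellOrder
  irrefl_of lt μ

theorem trans (hlt : IsMonomialOrder lt) {μ ν ρ : NF X} (h : lt μ ν) (h' : lt ν ρ) : lt μ ρ :=
  haveI := hlt.isWellOrder
  trans_of lt h h'

/-- Ensures that relabelling monomials along `g` never merges two terms, so no coefficients cancel.
-/
theorem injective (hlt : IsMonomialOrder lt) {g : NF X → NF X}
    (hg : ∀ μ ν, lt μ ν → lt (g μ) (g ν)) : Function.Injective g := by
  intro μ ν h
  rcases hlt.trichotomy μ ν with h' | h' | h'
  · exact absurd (h ▸ hg _ _ h') (hlt.irrefl _)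
  · exact h'
  · exact absurd (h ▸ hg _ _ h') (hlt.irrefl _)

/-! ### Leading monomials -/

theorem exists_leadingMonomial (hlt : IsMonomialOrder lt) {f : BC k X} (hf : f ≠ 0) :
    ∃ μ, IsLeadingMonomial lt f μ := by
  -- The support is finite, so the reversed order is well-founded on it; a minimum there is the
  -- largest monomial.
  have : IsStrictOrder (NF X) (Function.swap lt) :=
    { irrefl := hlt.irrefl, trans := fun _ _ _ h h' => hlt.trans h' h }
  have hne : ((BC.normalBasis k).repr f).support.Nonempty := by
    rw [Finsupp.support_nonempty_iff]
    simpa using hf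
  obtain ⟨μ, hμ, hmax⟩ := (Finset.finite_toSet _).wellFoundedOn (r := Function.swap lt)
    |>.has_min Set.univ ⟨⟨_, hne.choose_spec⟩, trivial⟩
  refine ⟨μ.1, Finsupp.mem_support_iff.1 μ.2, fun ν hν hne => ?_⟩
  rcases hlt.trichotomy ν μ.1 with h | h | h
  · exact h
  · exact absurd h hne
  · exact absurd h (hmax ⟨ν, Finsupp.mem_support_iff.2 hν⟩ trivial)

/-- A linear map that acts on the normal monomials in a strictly monotone way acts in the same way
on leading monomials. -/
theorem leadingMonomial_map (hlt : IsMonomialOrder lt) {g : NF X → NF X}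
    (hg : ∀ μ ν, lt μ ν → lt (g μ) (g ν)) (T : BC k X →ₗ[k] BC k X)
    (hT : ∀ μ, T (BC.monomial k μ) = BC.monomial k (g μ)) {f : BC k X} {μ : NF X}
    (hμ : IsLeadingMonomial lt f μ) : IsLeadingMonomial lt (T f) (g μ) := by
  have hinj := hlt.injective hg
  -- In coordinates `T` is relabelling along `g`; it suffices to compare on the basis.
  have key : (BC.normalBasis k).repr (T f) = ((BC.normalBasis k).repr f).mapDomain g := by
    have h : (BC.normalBasis k).repr.toLinearMap ∘ₗ T =
        Finsupp.lmapDomain k k g ∘ₗ (BC.normalBasis k).repr.toLinearMap := by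
      refine (BC.normalBasis k).ext fun ν => ?_
      simp only [LinearMap.comp_apply, LinearEquiv.coe_coe, Module.Basis.repr_self,
        Finsupp.lmapDomain_apply, Finsupp.mapDomain_single]
      rw [BC.normalBasis_apply, hT, ← BC.normalBasis_apply, Module.Basis.repr_self]
    exact LinearMap.congr_fun h f
  constructor
  · rw [key, Finsupp.mapDomain_apply hinj]
    exact hμ.1
  · intro ν hν hne
    rw [key] at hν
    by_cases h : ν ∈ Set.range g
    · obtain ⟨ν, rfl⟩ := h
      rw [Finsupp.mapDomain_apply hinj] at hν
      exact hg _ _ (hμ.2 ν hν fun e => hne (e ▸ rfl))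
    · exact absurd (Finsupp.mapDomain_of_notMem_range _ _ h) hν

theorem leadingMonomial_mul_left (hlt : IsMonomialOrder lt) (x : X) {f : BC k X} {μ : NF X}
    (hμ : IsLeadingMonomial lt f μ) : IsLeadingMonomial lt (BC.of k x * f) (.letter x * μ) :=
  hlt.leadingMonomial_map (g := fun ν => NF.letter x * ν) (fun _ _ => hlt.mul_left _ _ _)
    (LinearMap.mulLeft k (BC.of k x))
    (fun ν => (BC.monomial_mul k (.letter x) ν).symm) hμ

theorem leadingMonomial_mul_right (hlt : IsMonomialOrder lt) (x : X) {f : BC k X} {μ : NF X}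
    (hμ : IsLeadingMonomial lt f μ) : IsLeadingMonomial lt (f * BC.of k x) (μ * .letter x) :=
  hlt.leadingMonomial_map (g := fun ν => ν * NF.letter x) (fun _ _ => hlt.mul_right _ _ _)
    (LinearMap.mulRight k (BC.of k x))
    (fun ν => (BC.monomial_mul k ν (.letter x)).symm) hμ

/-- The leading monomial has to be a pair: right multiplication of a letter `x` by `y` gives
`[x;y]`, which turns `x` into the first word instead of enlarging an existing second word. -/
theorem leadingMonomial_lnormed (hlt : IsMonomialOrder lt) (ys : List X) {f : BC k X}
    {u v : Multiset X} (hu : u ≠ 0) (hv : v ≠ 0) (h : IsLeadingMonomial lt f (.pair u v hu hv)) :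
    IsLeadingMonomial lt (lnormed f (ys.map (BC.of k)))
      (.pair u (v + ys) hu (by simp [hv])) := by
  induction ys generalizing f v with
  | nil => simpa [lnormed] using h
  | cons y ys ih =>
    have := ih (v := y ::ₘ v) (by simp) (hlt.leadingMonomial_mul_right y h)
    simpa [lnormed, ← Multiset.cons_coe] using this

theorem leadingMonomial_rnormed (hlt : IsMonomialOrder lt) (zs : List X) {f : BC k X}
    {u v : Multiset X} (hu : u ≠ 0) (hv : v ≠ 0) (h : IsLeadingMonomial lt f (.pair u v hu hv)) :
    IsLeadingMonomial lt (rnormed (zs.map (BC.of k)) f)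
      (.pair (zs + u) v (by simp [hu]) hv) := by
  induction zs with
  | nil => simpa [rnormed] using h
  | cons z zs ih =>
    have e : (NF.pair (((z :: zs : List X) : Multiset X) + u) v (by simp) hv) =
        .letter z * .pair (zs + u) v (by simp [hu]) hv := by
      change _ = NF.pair (z ::ₘ (zs + u)) v _ _
      simp [← Multiset.cons_coe]
    rw [e]
    exact hlt.leadingMonomial_mul_left z ih

/-- Cancelling the leading term makes the leading monomial smaller. -/
theorem leadingMonomial_sub_smul {f h : BC k X} {μ ν : NF X}
    (hf : IsLeadingMonomial lt f μ) (hh : IsLeadingMonomial lt h μ)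
    (hν : IsLeadingMonomial lt
      (f - ((BC.normalBasis k).repr f μ / (BC.normalBasis k).repr h μ) • h) ν) : lt ν μ := by
  have h0 := hν.1
  simp only [map_sub, map_smul, Finsupp.sub_apply, Finsupp.smul_apply, smul_eq_mul] at h0
  by_cases e : ν = μ
  · subst e
    exact absurd (by rw [div_mul_cancel₀ _ hh.1, sub_self]) h0
  -- A monomial other than `μ` in the difference occurs in `f` or in `h`, and both have all their
  -- other terms below `μ`.
  · by_cases h1 : (BC.normalBasis k).repr f ν = 0
    · refine hh.2 ν (fun h2 => h0 ?_) e
      simp [h1, h2]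
    · exact hf.2 ν h1 e

end IsMonomialOrder

/-! ### Division with remainder by normal polynomials -/

section Existence

variable {k : Type*} [Field k] {X : Type*} {lt : NF X → NF X → Prop}

theorem exists_monic {I : Submodule k (BC k X)} {f : BC k X}
    (hf : f ∈ I) {μ : NF X} (hμ : IsLeadingMonomial lt f μ) :
    ∃ s ∈ I, IsMonicPoly lt s ∧ IsLeadingMonomial lt s μ := by
  have h0 := hμ.1
  have hs : IsLeadingMonomial lt (((BC.normalBasis k).repr f μ)⁻¹ • f) μ := by
    refine ⟨by simp [h0], fun ν hν => hμ.2 ν fun e => hν (by simp [e])⟩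
  exact ⟨_, I.smul_mem _ hf, ⟨μ, hs, by simp [h0]⟩, hs⟩

theorem subset_idealSpan (S : Set (BC k X)) : S ⊆ idealSpan k S := by
  intro s hs
  simp only [idealSpan, SetLike.mem_coe, Submodule.mem_sInf]
  exact fun J hJ => hJ.2 hs

theorem idealSpan_le {S : Set (BC k X)} {I : Submodule k (BC k X)} (hI : IsAlgIdeal I)
    (hS : S ⊆ I) : idealSpan k S ≤ I :=
  sInf_le ⟨hI, hS⟩

theorem IsNormalPoly.mem_idealSpan {S : Set (BC k X)} {h : BC k X} (hh : IsNormalPoly lt S h) :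
    h ∈ idealSpan k S := by
  have hI := isAlgIdeal_idealSpan k S
  induction hh with
  | base s hs => exact subset_idealSpan S hs
  | bracketed s hs μ hμ hl zs ys =>
    have h1 : ∀ (ys : List X) (f : BC k X), f ∈ idealSpan k S →
        lnormed f (ys.map (BC.of k)) ∈ idealSpan k S := by
      intro ys
      induction ys with
      | nil => exact fun f hf => hf
      | cons y ys ih => exact fun f hf => ih _ (hI (BC.of k y) f hf).2
    induction zs with
    | nil => exact h1 ys s (subset_idealSpan S hs)
    | cons z zs ih => exact (hI (BC.of k z) _ ih).1

/-- A set of monic elements of an ideal is a Gröbner–Shirshov basis if each leading monomial of the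
ideal is the one of a normal polynomial. -/
theorem isGroebnerShirshovBasis_of_leading (hlt : IsMonomialOrder lt) {I : Submodule k (BC k X)}
    (hI : IsAlgIdeal I) {S : Set (BC k X)} (hS : S ⊆ I) (hmonic : ∀ s ∈ S, IsMonicPoly lt s)
    (hlead : ∀ f ∈ I, ∀ μ, IsLeadingMonomial lt f μ →
      ∃ h, IsNormalPoly lt S h ∧ IsLeadingMonomial lt h μ) :
    IsGroebnerShirshovBasis lt S I := by
  have hle := idealSpan_le hI hS
  have hge : I ≤ idealSpan k S := by
    -- Well-founded induction on the leading monomial. The remainder `f - c • h` stays in `I`, so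
    -- the hypothesis on leading monomials applies to it again.
    have key : ∀ μ, ∀ f ∈ I, IsLeadingMonomial lt f μ → f ∈ idealSpan k S := by
      intro μ
      have := hlt.isWellOrder
      induction μ using (IsWellFounded.wf (r := lt)).induction with
      | _ μ ih =>
        intro f hf hμ
        obtain ⟨h, hh, hhμ⟩ := hlead f hf μ hμ
        have hhS := hh.mem_idealSpan
        set c := (BC.normalBasis k).repr f μ / (BC.normalBasis k).repr h μ with hc
        have hsub : f - c • h ∈ idealSpan k S := by
          by_cases h0 : f - c • h = 0
          · rw [h0]; exact Submodule.zero_mem _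
          · obtain ⟨ν, hν⟩ := hlt.exists_leadingMonomial h0
            exact ih ν (IsMonomialOrder.leadingMonomial_sub_smul hμ hhμ hν) _
              (I.sub_mem hf (I.smul_mem _ (hle hhS))) hν
        have := Submodule.add_mem _ hsub (Submodule.smul_mem _ c hhS)
        rwa [sub_add_cancel] at this
    intro f hf
    by_cases h0 : f = 0
    · rw [h0]; exact Submodule.zero_mem _
    · obtain ⟨μ, hμ⟩ := hlt.exists_leadingMonomial h0
      exact key μ f hf hμ
  refine ⟨hmonic, le_antisymm hle hge, fun f hf h0 => ?_⟩
  obtain ⟨μ, hμ⟩ := hlt.exists_leadingMonomial h0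
  obtain ⟨h, hh, hhμ⟩ := hlead f (hle hf) μ hμ
  exact ⟨h, μ, hh, hμ, hhμ⟩

end Existence

/-! ### Finiteness from minimal pairs -/

theorem mainTheorem2 {k : Type*} [Field k] {X : Type*} [Finite X]
    (lt : NF X → NF X → Prop) (hlt : IsMonomialOrder lt)
    (I : Submodule k (BC k X)) (hI : IsAlgIdeal I) :
    ∃ S : Set (BC k X), S.Finite ∧ IsGroebnerShirshovBasis lt S I := by
  let L : Set (NF X) := {μ | ∃ f ∈ I, IsLeadingMonomial lt f μ}
  have hs : ∀ μ : L, ∃ s ∈ I, IsMonicPoly lt s ∧ IsLeadingMonomial lt s μ :=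
    fun μ => exists_monic μ.2.choose_spec.1 μ.2.choose_spec.2
  choose s hsI hsm hsl using hs
  let P : Multiset X × Multiset X → Prop := fun p => ∃ hu hv, NF.pair p.1 p.2 hu hv ∈ L
  -- Minimal elements form an antichain, and a product of two well-quasi-orders has only finite
  -- antichains.
  have hfin : {p | Minimal P p}.Finite :=
    WellQuasiOrderedLE.finite_of_isAntichain (setOfPred_minimal_antichain P)
  -- All letters are admitted here; those that lead no element of `I` drop out when `M` is pulled
  -- back to `L`.
  let M : Set (NF X) := Set.range NF.letter ∪
    {μ | ∃ p, Minimal P p ∧ ∃ hu hv, μ = NF.pair p.1 p.2 hu hv}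
  have hM : M.Finite := by
    refine (Set.finite_range _).union
      ((hfin.biUnion (t := fun p => {μ | ∃ hu hv, μ = NF.pair p.1 p.2 hu hv}) fun p _ =>
        Set.Subsingleton.finite ?_).subset ?_)
    · rintro _ ⟨_, _, rfl⟩ _ ⟨_, _, rfl⟩
      rfl
    · rintro μ ⟨p, hp, h⟩
      exact Set.mem_biUnion (x := p) hp h
  refine ⟨s '' {μ | μ.1 ∈ M}, (hM.preimage Subtype.val_injective.injOn).image s,
    isGroebnerShirshovBasis_of_leading hlt hI ?_ ?_ ?_⟩
  · rintro _ ⟨μ, _, rfl⟩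
    exact hsI μ
  · rintro _ ⟨μ, _, rfl⟩
    exact hsm μ
  · intro f hf μ hμ
    have hμL : μ ∈ L := ⟨f, hf, hμ⟩
    rcases μ with x | ⟨u, v, hu, hv⟩
    · exact ⟨s ⟨_, hμL⟩, .base _ ⟨_, Or.inl ⟨x, rfl⟩, rfl⟩, hsl _⟩
    -- The quotients of `u` and `v` by a minimal pair below them supply the letters `zs` and `ys` of
    -- the bracketing.
    · obtain ⟨⟨u₀, v₀⟩, hle, hmin⟩ :=
        exists_minimal_le_of_wellFoundedLT P (u, v) ⟨hu, hv, hμL⟩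
      obtain ⟨hu₀, hv₀, h₀⟩ := hmin.prop
      obtain ⟨zs, rfl⟩ := Multiset.le_iff_exists_add.1 hle.1
      obtain ⟨ys, rfl⟩ := Multiset.le_iff_exists_add.1 hle.2
      obtain ⟨zs, rfl⟩ : ∃ l : List X, zs = l := ⟨_, zs.coe_toList.symm⟩
      obtain ⟨ys, rfl⟩ : ∃ l : List X, ys = l := ⟨_, ys.coe_toList.symm⟩
      have hmem : s ⟨_, h₀⟩ ∈ s '' {μ | μ.1 ∈ M} :=
        ⟨⟨_, h₀⟩, Or.inr ⟨_, hmin, hu₀, hv₀, rfl⟩, rfl⟩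
      refine ⟨_, .bracketed _ hmem _ (hsl _) ?_ zs ys, ?_⟩
      -- Both words of a pair are nonempty, hence the length is at least two.
      · have h1 := Multiset.card_pos.2 hu₀
        have h2 := Multiset.card_pos.2 hv₀
        simp only [NF.length] at h1 h2 ⊢
        omega
      · have := hlt.leadingMonomial_rnormed zs _ _
          (hlt.leadingMonomial_lnormed ys hu₀ hv₀ (hsl ⟨_, h₀⟩))
        convert this using 2
        exact add_comm _ _
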